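/- **Theorem 3.6.** Let $(\mathcal X,\|\cdot\|)$ be a separable Banach space which is $(2,D)$-smooth for some $D>0$, i.e. $$\|x+y\|^2+\|x-y\|^2\le 2\|x\|^2+2D^2\|y\|^2\qquad\text{for all }x,y\in\mathcal X.$$ Let $f=(f_j)_{j\ge 0}$ be an $\mathcal X$-valued martingale of Bochner-integrable random vectors with $f_0\equiv 0$, on a probability space $(\Omega,F,\mathbf P)$, with respect to a filtration $(F_j)_{j\ge 0}$. Put $d_j=f_j-f_{j-1}$ for $j\ge 1$, $$f^*=\sup_{j\ge 0}\|f_j\|\in[0,\infty],\qquad S_2(f)=\Big(\sum_{j=1}^\infty\|d_j\|^2\Big)^{1/2}\in[0,\infty].$$ Suppose that $\|S_2(f)\|_\infty\le b$ for some real $b>0$, where $\|\cdot\|_\infty$ is the $L^\infty(\mathbf P)$-norm (essential supremum), and that for every $j\ge 1$ the increment $d_j$ is $F_{j-1}$-conditionally symmetrically distributed, i.e. $\mathbf P(d_j\in B\mid F_{j-1})=\mathbf P(-d_j\in B\mid F_{j-1})$ almost surely for every Borel set $B\subseteq\mathcal X$. Then for all $r\ge 0$, $$\mathbf P(f^*\ge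 r)\le 2\exp\Big(-\frac{r^2}{2D^2b^2}\Big).$$ -/

import Mathlib

open MeasureTheory ProbabilityTheory
open scoped ENNReal

namespace BanachMartingale

/-- The normed space `X` is `(2, D)`-smooth, where `D > 0`. -/
def IsTwoSmooth (X : Type*) [NormedAddCommGroup X] (D : ℝ) : Prop :=
  0 < D ∧ ∀ x y : X, ‖x + y‖ ^ 2 + ‖x - y‖ ^ 2 ≤ 2 * ‖x‖ ^ 2 + 2 * D ^ 2 * ‖y‖ ^ 2

/-- The increments `d_j = f_j - f_{j-1}` for `j ≥ 1`; since `0 - 1 = 0` in `ℕ`, `d_0 = 0`. -/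
def increment {Ω X : Type*} [NormedAddCommGroup X] (f : ℕ → Ω → X) (j : ℕ) (ω : Ω) : X :=
  f j ω - f (j - 1) ω

/-- The maximal function `f^* = sup_{j ≥ 0} ‖f_j‖`, with values in `[0, ∞]`. -/
noncomputable def maximalFunction {Ω X : Type*} [NormedAddCommGroup X]
    (f : ℕ → Ω → X) (ω : Ω) : ℝ≥0∞ :=
  ⨆ j : ℕ, ‖f j ω‖ₑ

/-- The square function `S_2(f) = (∑_{j ≥ 1} ‖d_j‖ ^ 2) ^ (1 / 2)`, with values in `[0, ∞]`. -/
noncomputable def squareFunction {Ω X : Type*} [NormedAddCommGroup X]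
    (f : ℕ → Ω → X) (ω : Ω) : ℝ≥0∞ :=
  (∑' j : ℕ, ‖increment f (j + 1) ω‖ₑ ^ 2) ^ (1 / 2 : ℝ)

/-- The random vector `d` is conditionally symmetrically distributed given the sub-σ-algebra `m`:
for every Borel set `B`, `P(d ∈ B | m) = P(-d ∈ B | m)` almost surely. -/
def CondSymmetric {Ω X : Type*} [NormedAddCommGroup X] [MeasurableSpace X]
    (m : MeasurableSpace Ω) {m0 : MeasurableSpace Ω} (d : Ω → X) (μ : Measure Ω) : Prop :=
  ∀ B : Set X, MeasurableSet B →
    μ⟦{ω | d ω ∈ B} | m⟧ =ᵐ[μ] μ⟦{ω | -d ω ∈ B} | m⟧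

end BanachMartingale

namespace BanachMartingale

/-! For `κ = l² D² / 2` the process `cosh (l ‖f_n‖) exp (-κ ∑ ‖d_i‖ ^ 2)` is a supermartingale
starting at `1`. Its weight is even in the newest increment, so conditional symmetry permits
averaging over `f_n ± d_{n+1}`, and smoothness bounds that average (`IsTwoSmooth.cosh_add_cosh_le`).
Once `‖f_n‖ ≥ s`, the process is at least `exp (l s) / 2 * exp (-κ b ^ 2)`; a maximal inequality and
the best `l` finish. -/

/-! ### Inequalities for `cosh` and smooth norms -/

/-- Convexity of `t ^ n` on `t ≥ 0`: the interval `[A, P]` lies to the right of `[Q, C]` and is at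
least as long. -/
lemma pow_sub_pow_le_pow_sub_pow {P A C Q : ℝ} (hQ : 0 ≤ Q) (hQC : Q ≤ C) (hCA : C ≤ A)
    (hAP : A ≤ P) (h : C - Q ≤ P - A) (n : ℕ) : C ^ n - Q ^ n ≤ P ^ n - A ^ n := by
  induction n with
  | zero => simp
  | succ n ih =>
    have h1 : 0 ≤ C ^ n - Q ^ n := sub_nonneg.2 (pow_le_pow_left₀ hQ hQC n)
    have h2 : Q ^ n ≤ A ^ n := pow_le_pow_left₀ hQ (hQC.trans hCA) n
    have h3 : C * (C ^ n - Q ^ n) ≤ P * (P ^ n - A ^ n) :=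
      mul_le_mul (hCA.trans hAP) ih h1 (hQ.trans (hQC.trans (hCA.trans hAP)))
    have h4 : Q ^ n * (C - Q) ≤ A ^ n * (P - A) :=
      mul_le_mul h2 h (sub_nonneg.2 hQC) ((pow_nonneg hQ n).trans h2)
    calc C ^ (n + 1) - Q ^ (n + 1) = C * (C ^ n - Q ^ n) + Q ^ n * (C - Q) := by ring
      _ ≤ P * (P ^ n - A ^ n) + A ^ n * (P - A) := add_le_add h3 h4
      _ = P ^ (n + 1) - A ^ (n + 1) := by ring

/-- `cosh` satisfies the weak majorization inequality in terms of the squares of its arguments. -/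
lemma cosh_add_cosh_le_of_sq {a c p q : ℝ} (hcp : c ^ 2 ≤ a ^ 2) (hap : a ^ 2 ≤ p ^ 2)
    (h : a ^ 2 + c ^ 2 ≤ p ^ 2 + q ^ 2) :
    Real.cosh a + Real.cosh c ≤ Real.cosh p + Real.cosh q := by
  rcases le_total (c ^ 2) (q ^ 2) with hcq | hqc
  · exact add_le_add (Real.cosh_le_cosh.2 (sq_le_sq.1 hap)) (Real.cosh_le_cosh.2 (sq_le_sq.1 hcq))
  -- The Taylor series of `cosh` is a power series in the squared argument with positive
  -- coefficients, so the terms can be compared one by one.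
  · refine hasSum_le (fun n ↦ ?_) ((Real.hasSum_cosh a).add (Real.hasSum_cosh c))
      ((Real.hasSum_cosh p).add (Real.hasSum_cosh q))
    have := pow_sub_pow_le_pow_sub_pow (sq_nonneg q) hqc hcp hap (by linarith) n
    rw [← add_div, ← add_div]
    simp only [pow_mul]
    gcongr ?_ / _
    linarith

/-- In a `(2, D)`-smooth space, averaging `cosh (l * ‖·‖)` over `x ± y` costs at most a Gaussian
factor in `‖y‖`. -/
lemma IsTwoSmooth.cosh_add_cosh_le {X : Type*} [NormedAddCommGroup X]
    {D : ℝ} (hX : IsTwoSmooth X D) (l : ℝ) (x y : X) :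
    Real.cosh (l * ‖x + y‖) + Real.cosh (l * ‖x - y‖) ≤
      2 * (Real.cosh (l * ‖x‖) * Real.exp (l ^ 2 * D ^ 2 / 2 * ‖y‖ ^ 2)) := by
  obtain ⟨hD, hsm⟩ := hX
  have hDy : ‖y‖ ≤ D * ‖y‖ := by
    have := hsm 0 y
    simp only [zero_add, zero_sub, norm_neg, norm_zero] at this
    refine le_of_sq_le_sq ?_ (by positivity)
    nlinarith
  -- The squares of `‖x‖ ± D ‖y‖` sum to exactly the smoothness bound; these two numbers are the
  -- extremal pair.
  have key : ∀ a c : ℝ, 0 ≤ a → 0 ≤ c → c ≤ a → a ≤ ‖x‖ + ‖y‖ →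
      a ^ 2 + c ^ 2 ≤ 2 * ‖x‖ ^ 2 + 2 * D ^ 2 * ‖y‖ ^ 2 →
      Real.cosh (l * a) + Real.cosh (l * c) ≤
        Real.cosh (l * (‖x‖ + D * ‖y‖)) + Real.cosh (l * (‖x‖ - D * ‖y‖)) := by
    intro a c ha hc hca hax hs
    refine cosh_add_cosh_le_of_sq ?_ ?_ ?_
    · rw [mul_pow, mul_pow]; gcongr
    · rw [mul_pow, mul_pow]; gcongr; linarith
    · have : l ^ 2 * (a ^ 2 + c ^ 2) ≤ l ^ 2 * (2 * ‖x‖ ^ 2 + 2 * D ^ 2 * ‖y‖ ^ 2) := by gcongr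
      linarith
  have h1 : Real.cosh (l * ‖x + y‖) + Real.cosh (l * ‖x - y‖) ≤
      Real.cosh (l * (‖x‖ + D * ‖y‖)) + Real.cosh (l * (‖x‖ - D * ‖y‖)) := by
    rcases le_total ‖x - y‖ ‖x + y‖ with h | h
    · exact key _ _ (norm_nonneg _) (norm_nonneg _) h (norm_add_le x y) (hsm x y)
    · rw [add_comm]
      exact key _ _ (norm_nonneg _) (norm_nonneg _) h (norm_sub_le x y)
        (by rw [add_comm]; exact hsm x y)
  have h2 : Real.cosh (l * (‖x‖ + D * ‖y‖)) + Real.cosh (l * (‖x‖ - D * ‖y‖)) =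
      2 * (Real.cosh (l * ‖x‖) * Real.cosh (l * D * ‖y‖)) := by
    rw [mul_add, mul_sub, Real.cosh_add, Real.cosh_sub, ← mul_assoc l D]; ring
  have h3 : Real.cosh (l * D * ‖y‖) ≤ Real.exp (l ^ 2 * D ^ 2 / 2 * ‖y‖ ^ 2) := by
    convert Real.cosh_le_exp_half_sq (l * D * ‖y‖) using 2; ring
  rw [h2] at h1
  refine h1.trans ?_
  have := (Real.cosh_pos (l * ‖x‖)).le
  gcongr

/-! ### Conditional symmetry and the supermartingale -/

/-- If `d` is conditionally symmetric given `m`, then `d` and `-d` have the same joint law with any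
`m`-measurable random element. -/
lemma CondSymmetric.map_prodMk_eq {Ω X S : Type*} [NormedAddCommGroup X] [MeasurableSpace X]
    [MeasurableNeg X] [MeasurableSpace S] {m m0 : MeasurableSpace Ω} (hm : m ≤ m0)
    {μ : Measure Ω} [IsFiniteMeasure μ] {d : Ω → X} (hd : Measurable d) {g : Ω → S}
    (hg : Measurable[m] g) (h : CondSymmetric m d μ) :
    μ.map (fun ω ↦ (g ω, d ω)) = μ.map (fun ω ↦ (g ω, -d ω)) := by
  have hg0 : Measurable g := hg.mono hm le_rfl
  have hdn : Measurable fun ω ↦ -d ω := hd.neg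
  refine Measure.ext_prod fun {s t} hs ht ↦ ?_
  rw [Measure.map_apply (hg0.prodMk hd) (hs.prod ht),
    Measure.map_apply (hg0.prodMk hdn) (hs.prod ht)]
  -- Rectangles determine the joint law, and integrating a conditional probability over the
  -- `m`-measurable set `g ⁻¹' s` gives the measure of a rectangle's preimage.
  have aux : ∀ e : Ω → X, Measurable e →
      ∫ ω in g ⁻¹' s, (μ⟦{ω | e ω ∈ t} | m⟧) ω ∂μ = μ.real (g ⁻¹' s ∩ e ⁻¹' t) := by
    intro e he
    have het : MeasurableSet (e ⁻¹' t) := he ht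
    have hi : Integrable ((e ⁻¹' t).indicator fun _ ↦ (1 : ℝ)) μ :=
      (integrable_const 1).indicator het
    change ∫ ω in g ⁻¹' s, (μ[(e ⁻¹' t).indicator fun _ ↦ (1 : ℝ) | m]) ω ∂μ = _
    rw [setIntegral_condExp hm hi (hg hs), setIntegral_indicator het]
    simp
  have key : μ.real (g ⁻¹' s ∩ d ⁻¹' t) = μ.real (g ⁻¹' s ∩ (fun ω ↦ -d ω) ⁻¹' t) := by
    rw [← aux d hd, ← aux (fun ω ↦ -d ω) hdn]
    exact integral_congr_ae (ae_restrict_of_ae (h t ht))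
  exact (measureReal_eq_measureReal_iff).1 key

lemma sum_norm_increment_sq_le {Ω X : Type*} [NormedAddCommGroup X] {f : ℕ → Ω → X} {ω : Ω}
    {b : ℝ} (hb : 0 ≤ b) (h : squareFunction f ω ≤ ENNReal.ofReal b) (n : ℕ) :
    ∑ i ∈ Finset.range n, ‖increment f (i + 1) ω‖ ^ 2 ≤ b ^ 2 := by
  have h1 : ∑' j : ℕ, ‖increment f (j + 1) ω‖ₑ ^ 2 ≤ ENNReal.ofReal b ^ 2 := by
    have := ENNReal.rpow_le_rpow h (z := 2) (by norm_num)
    rw [squareFunction, ← ENNReal.rpow_mul] at this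
    norm_num at this
    exact_mod_cast this
  have h2 := (ENNReal.sum_le_tsum (Finset.range n)).trans h1
  rw [← ENNReal.ofReal_pow hb] at h2
  refine (ENNReal.ofReal_le_ofReal_iff (sq_nonneg b)).1 (le_of_eq_of_le ?_ h2)
  rw [ENNReal.ofReal_sum_of_nonneg fun i _ ↦ sq_nonneg _]
  exact Finset.sum_congr rfl fun i _ ↦ by rw [ENNReal.ofReal_pow (norm_nonneg _), ofReal_norm]

/-- The exponential weight `exp (-κ ∑_{1 ≤ i ≤ n} ‖d_i‖ ^ 2)`. -/
noncomputable def expWeight {Ω X : Type*} [NormedAddCommGroup X] (κ : ℝ) (f : ℕ → Ω → X)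
    (n : ℕ) (ω : Ω) : ℝ :=
  Real.exp (-(κ * ∑ i ∈ Finset.range n, ‖increment f (i + 1) ω‖ ^ 2))

lemma expWeight_pos {Ω X : Type*} [NormedAddCommGroup X] (κ : ℝ) (f : ℕ → Ω → X) (n : ℕ) (ω : Ω) :
    0 < expWeight κ f n ω :=
  Real.exp_pos _

/-- The process `cosh (l ‖f_n‖) exp (-κ ∑_{1 ≤ i ≤ n} ‖d_i‖ ^ 2)`. -/
noncomputable def coshProcess {Ω X : Type*} [NormedAddCommGroup X] (l κ : ℝ) (f : ℕ → Ω → X)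
    (n : ℕ) (ω : Ω) : ℝ≥0∞ :=
  ENNReal.ofReal (Real.cosh (l * ‖f n ω‖) * expWeight κ f n ω)

section Supermartingale

variable {X : Type*} [NormedAddCommGroup X] [SecondCountableTopology X] [MeasurableSpace X]
  [BorelSpace X] {Ω : Type*} {m0 : MeasurableSpace Ω} {ℱ : Filtration ℕ m0} {f : ℕ → Ω → X}

lemma measurable_increment (hf : ∀ n, Measurable[ℱ n] (f n)) (n : ℕ) :
    Measurable[ℱ n] (increment f n) :=
  (hf n).sub ((hf (n - 1)).mono (ℱ.mono (Nat.sub_le n 1)) le_rfl)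

lemma measurable_expWeight (hf : ∀ n, Measurable[ℱ n] (f n)) (κ : ℝ) (n : ℕ) :
    Measurable[ℱ n] (expWeight κ f n) := by
  refine Real.measurable_exp.comp (Measurable.neg (Measurable.const_mul ?_ κ))
  refine Finset.measurable_sum _ fun i hi ↦ ?_
  have h : Measurable[ℱ n] (increment f (i + 1)) :=
    (measurable_increment hf (i + 1)).mono (ℱ.mono (Finset.mem_range.1 hi)) le_rfl
  exact (measurable_norm.comp h).pow_const 2

lemma measurable_coshProcess (hf : ∀ n, Measurable[ℱ n] (f n)) (l κ : ℝ) (n : ℕ) :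
    Measurable[ℱ n] (coshProcess l κ f n) :=
  ENNReal.measurable_ofReal.comp <| Measurable.mul
    (Real.measurable_cosh.comp (Measurable.const_mul (measurable_norm.comp (hf n)) l))
    (measurable_expWeight hf κ n)

/-- The supermartingale property of `coshProcess`. -/
lemma setLIntegral_coshProcess_succ_le {μ : Measure Ω} [IsFiniteMeasure μ] {D : ℝ}
    (hX : IsTwoSmooth X D) (hf : ∀ n, Measurable[ℱ n] (f n))
    (hsymm : ∀ j, 1 ≤ j → CondSymmetric (ℱ (j - 1)) (increment f j) μ) (l : ℝ) (n : ℕ)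
    {A : Set Ω} (hA : MeasurableSet[ℱ n] A) :
    ∫⁻ ω in A, coshProcess l (l ^ 2 * D ^ 2 / 2) f (n + 1) ω ∂μ ≤
      ∫⁻ ω in A, coshProcess l (l ^ 2 * D ^ 2 / 2) f n ω ∂μ := by
  set κ := l ^ 2 * D ^ 2 / 2 with hκ
  set d := increment f (n + 1) with hd
  have hA0 : MeasurableSet A := ℱ.le n A hA
  have hdm : Measurable d := (measurable_increment hf (n + 1)).mono (ℱ.le _) le_rfl
  have hdn : Measurable fun ω ↦ -d ω := hdm.neg
  -- The set `A` and the past weight are packed into one `ℱ n`-measurable factor, so that the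
  -- integrand depends only on the pair `(g, d)`.
  let w : Ω → ℝ≥0∞ := A.indicator fun ω ↦ ENNReal.ofReal (expWeight κ f n ω)
  have hw : Measurable[ℱ n] w :=
    (ENNReal.measurable_ofReal.comp (measurable_expWeight hf κ n)).indicator hA
  let g : Ω → X × ℝ≥0∞ := fun ω ↦ (f n ω, w ω)
  have hg : Measurable[ℱ n] g := (hf n).prodMk hw
  have hg0 : Measurable g := hg.mono (ℱ.le n) le_rfl
  let Φ : (X × ℝ≥0∞) × X → ℝ≥0∞ := fun z ↦
    z.1.2 * ENNReal.ofReal (Real.cosh (l * ‖z.1.1 + z.2‖) * Real.exp (-(κ * ‖z.2‖ ^ 2)))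
  have hΦ : Measurable Φ := by
    have := Real.measurable_cosh
    have := Real.measurable_exp
    fun_prop
  have hlaw : ∫⁻ ω, Φ (g ω, d ω) ∂μ = ∫⁻ ω, Φ (g ω, -d ω) ∂μ := by
    have := (hsymm (n + 1) (by omega)).map_prodMk_eq (ℱ.le _) hdm hg
    rw [← lintegral_map hΦ (hg0.prodMk hdm), this, lintegral_map hΦ (hg0.prodMk hdn)]
  have h1 : ∫⁻ ω in A, coshProcess l κ f (n + 1) ω ∂μ = ∫⁻ ω, Φ (g ω, d ω) ∂μ := by
    rw [← lintegral_indicator hA0]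
    refine lintegral_congr fun ω ↦ ?_
    by_cases hω : ω ∈ A
    · have hfd : f n ω + d ω = f (n + 1) ω := by simp [hd, increment]
      simp only [Set.indicator_of_mem hω, Φ, g, w, coshProcess, hfd]
      rw [← ENNReal.ofReal_mul (expWeight_pos κ f n ω).le]
      congr 1
      simp only [expWeight, Finset.sum_range_succ, mul_add, neg_add, Real.exp_add]
      ring
    · simp [Φ, g, w, hω]
  have h2 : ∫⁻ ω in A, coshProcess l κ f n ω ∂μ =
      ∫⁻ ω, w ω * ENNReal.ofReal (Real.cosh (l * ‖f n ω‖)) ∂μ := by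
    rw [← lintegral_indicator hA0]
    refine lintegral_congr fun ω ↦ ?_
    by_cases hω : ω ∈ A
    · simp only [Set.indicator_of_mem hω, w, coshProcess]
      rw [← ENNReal.ofReal_mul (expWeight_pos κ f n ω).le, mul_comm]
    · simp [w, hω]
  have hpt : ∀ ω, Φ (g ω, d ω) + Φ (g ω, -d ω) ≤
      2 * (w ω * ENNReal.ofReal (Real.cosh (l * ‖f n ω‖))) := by
    intro ω
    have hc : ∀ x : ℝ, 0 ≤ Real.cosh x := fun x ↦ (Real.cosh_pos x).le
    simp only [Φ, g, norm_neg, ← sub_eq_add_neg]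
    rw [← mul_add, mul_left_comm,
      ← ENNReal.ofReal_add (mul_nonneg (hc _) (Real.exp_pos _).le)
        (mul_nonneg (hc _) (Real.exp_pos _).le), ← add_mul,
      show (2 : ℝ≥0∞) = ENNReal.ofReal 2 by simp, ← ENNReal.ofReal_mul zero_le_two]
    refine mul_le_mul_right (ENNReal.ofReal_le_ofReal ?_) (w ω)
    rw [Real.exp_neg, ← div_eq_mul_inv, div_le_iff₀ (Real.exp_pos _), mul_assoc]
    exact hX.cosh_add_cosh_le l (f n ω) (d ω)
  rw [h1, h2]
  refine (ENNReal.mul_le_mul_iff_right two_ne_zero ENNReal.ofNat_ne_top).1 ?_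
  calc 2 * ∫⁻ ω, Φ (g ω, d ω) ∂μ = ∫⁻ ω, Φ (g ω, d ω) ∂μ + ∫⁻ ω, Φ (g ω, -d ω) ∂μ := by
        rw [← hlaw, two_mul]
    _ = ∫⁻ ω, (Φ (g ω, d ω) + Φ (g ω, -d ω)) ∂μ :=
        (lintegral_add_left (hΦ.comp (hg0.prodMk hdm)) _).symm
    _ ≤ ∫⁻ ω, 2 * (w ω * ENNReal.ofReal (Real.cosh (l * ‖f n ω‖))) ∂μ := lintegral_mono hpt
    _ = 2 * ∫⁻ ω, w ω * ENNReal.ofReal (Real.cosh (l * ‖f n ω‖)) ∂μ :=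
        lintegral_const_mul' _ _ ENNReal.ofNat_ne_top

end Supermartingale

/-! ### Maximal inequality and tail bound -/

/-- A maximal inequality for a nonnegative process `Z` with the supermartingale property: if `Z`
is at least `c` on each of the adapted events `G n`, then `c * μ (⋃ n, G n) ≤ ∫ Z 0`. -/
lemma mul_measure_iUnion_le_lintegral {Ω : Type*} {m0 : MeasurableSpace Ω} {μ : Measure Ω}
    {ℱ : Filtration ℕ m0} {Z : ℕ → Ω → ℝ≥0∞} {G : ℕ → Set Ω}
    (hG : ∀ n, MeasurableSet[ℱ n] (G n))
    (hZ : ∀ n A, MeasurableSet[ℱ n] A → ∫⁻ ω in A, Z (n + 1) ω ∂μ ≤ ∫⁻ ω in A, Z n ω ∂μ)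
    {c : ℝ≥0∞} (hc : ∀ n, ∀ᵐ ω ∂μ, ω ∈ G n → c ≤ Z n ω) :
    c * μ (⋃ n, G n) ≤ ∫⁻ ω, Z 0 ω ∂μ := by
  have hE : ∀ n, MeasurableSet[ℱ n] (Set.accumulate G n) := fun n ↦ by
    rw [Set.accumulate_def]
    exact MeasurableSet.biUnion (Set.to_countable _) fun i hi ↦ ℱ.mono hi _ (hG i)
  have hG0 : ∀ n, MeasurableSet (G n) := fun n ↦ ℱ.le n _ (hG n)
  have hE0 : ∀ n, MeasurableSet (Set.accumulate G n) := fun n ↦ ℱ.le n _ (hE n)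
  have hstep : ∀ n (A : Set Ω), MeasurableSet A →
      c * μ (A ∩ G n) + ∫⁻ ω in A \ G n, Z n ω ∂μ ≤ ∫⁻ ω in A, Z n ω ∂μ := by
    intro n A hA
    rw [← lintegral_inter_add_sdiff _ A (hG0 n), ← setLIntegral_const]
    gcongr ?_ + _
    refine setLIntegral_mono_ae' (hA.inter (hG0 n)) ?_
    filter_upwards [hc n] with ω hω hmem using hω hmem.2
  -- This is optional stopping at the first entry into some `G n`: the entered part is charged `c`,
  -- the rest still carries `Z n`.
  have main : ∀ n, c * μ (Set.accumulate G n) + ∫⁻ ω in (Set.accumulate G n)ᶜ, Z n ω ∂μ ≤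
      ∫⁻ ω, Z 0 ω ∂μ := by
    intro n
    induction n with
    | zero =>
      have := hstep 0 Set.univ MeasurableSet.univ
      simpa [Set.accumulate_zero_nat, Set.compl_eq_univ_sdiff] using this
    | succ n ih =>
      have hs := hstep (n + 1) _ (hE0 n).compl
      have hsplit : μ (Set.accumulate G (n + 1)) =
          μ (Set.accumulate G n) + μ ((Set.accumulate G n)ᶜ ∩ G (n + 1)) := by
        rw [Set.accumulate_succ, ← measure_union
          (disjoint_compl_right.mono_right Set.inter_subset_left) ((hE0 n).compl.inter (hG0 _)),
          Set.union_inter_distrib_left, Set.union_compl_self, Set.univ_inter]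
      have hcompl : (Set.accumulate G (n + 1))ᶜ = (Set.accumulate G n)ᶜ \ G (n + 1) := by
        rw [Set.accumulate_succ, Set.compl_union, Set.sdiff_eq]
      rw [hsplit, hcompl, mul_add, add_assoc]
      exact (add_le_add le_rfl (hs.trans (hZ n _ (hE n).compl))).trans ih
  rw [← Set.iUnion_accumulate, Set.monotone_accumulate.measure_iUnion, ENNReal.mul_iSup]
  exact iSup_le fun n ↦ le_self_add.trans (main n)

/-- The exponential tail bound with a free parameter `l`. -/
lemma measureReal_iUnion_le {X : Type*} [NormedAddCommGroup X] [SecondCountableTopology X]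
    [MeasurableSpace X] [BorelSpace X] {D : ℝ} (hX : IsTwoSmooth X D)
    {Ω : Type*} {m0 : MeasurableSpace Ω} {μ : Measure Ω} [IsProbabilityMeasure μ]
    {ℱ : Filtration ℕ m0} {f : ℕ → Ω → X} (hf : ∀ n, Measurable[ℱ n] (f n)) (hf0 : f 0 = 0)
    {b : ℝ} (hb : 0 ≤ b) (hS : ∀ᵐ ω ∂μ, squareFunction f ω ≤ ENNReal.ofReal b)
    (hsymm : ∀ j, 1 ≤ j → CondSymmetric (ℱ (j - 1)) (increment f j) μ)
    {l : ℝ} (hl : 0 ≤ l) (s : ℝ) :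
    μ.real (⋃ n, {ω | s ≤ ‖f n ω‖}) ≤
      2 * Real.exp (l ^ 2 * D ^ 2 / 2 * b ^ 2 - l * s) := by
  set κ := l ^ 2 * D ^ 2 / 2 with hκ
  -- The bound `cosh t ≥ exp t / 2` is the source of the final factor `2`.
  set c : ℝ := Real.exp (l * s) / 2 * Real.exp (-(κ * b ^ 2)) with hc
  have hcpos : 0 < c := by positivity
  have hmax := mul_measure_iUnion_le_lintegral (μ := μ) (ℱ := ℱ) (Z := coshProcess l κ f)
    (G := fun n ↦ {ω | s ≤ ‖f n ω‖}) (c := ENNReal.ofReal c)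
    (fun n ↦ measurableSet_le measurable_const (measurable_norm.comp (hf n)))
    (fun n A hA ↦ setLIntegral_coshProcess_succ_le hX hf hsymm l n hA) (fun n ↦ by
      filter_upwards [hS] with ω hω hs
      have hs : s ≤ ‖f n ω‖ := hs
      refine ENNReal.ofReal_le_ofReal (mul_le_mul ?_ ?_ (Real.exp_pos _).le (Real.cosh_pos _).le)
      · rw [Real.cosh_eq]
        have : Real.exp (l * s) ≤ Real.exp (l * ‖f n ω‖) := by gcongr
        linarith [Real.exp_pos (-(l * ‖f n ω‖))]
      · refine Real.exp_le_exp.2 (neg_le_neg ?_)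
        have := sum_norm_increment_sq_le hb hω n
        gcongr)
  have h0 : ∫⁻ ω, coshProcess l κ f 0 ω ∂μ = 1 := by simp [coshProcess, expWeight, hf0]
  rw [h0] at hmax
  have h1 : c * μ.real (⋃ n, {ω | s ≤ ‖f n ω‖}) ≤ 1 := by
    have := ENNReal.toReal_mono ENNReal.one_ne_top hmax
    simpa [ENNReal.toReal_mul, hcpos.le, Measure.real] using this
  have h2 : 2 * Real.exp (κ * b ^ 2 - l * s) = 1 / c := by
    rw [hc, Real.exp_sub, Real.exp_neg]
    field_simp
  rw [h2, le_div_iff₀ hcpos, mul_comm]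
  exact h1

end BanachMartingale

theorem theorem3p6 {X : Type*} [NormedAddCommGroup X] [NormedSpace ℝ X] [CompleteSpace X]
    [TopologicalSpace.SeparableSpace X] [MeasurableSpace X] [BorelSpace X]
    {D : ℝ} (hX : BanachMartingale.IsTwoSmooth X D)
    {Ω : Type*} {m0 : MeasurableSpace Ω} {μ : Measure Ω} [IsProbabilityMeasure μ]
    {ℱ : Filtration ℕ m0} {f : ℕ → Ω → X} (hf : Martingale f ℱ μ) (hf0 : f 0 = 0)
    {b : ℝ} (hb : 0 < b)
    (hS : eLpNorm (BanachMartingale.squareFunction f) ∞ μ ≤ ENNReal.ofReal b)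
    (hsymm : ∀ j : ℕ, 1 ≤ j →
      BanachMartingale.CondSymmetric (ℱ (j - 1)) (BanachMartingale.increment f j) μ)
    {r : ℝ} (hr : 0 ≤ r) :
    μ.real {ω | ENNReal.ofReal r ≤ BanachMartingale.maximalFunction f ω} ≤
      2 * Real.exp (-(r ^ 2 / (2 * D ^ 2 * b ^ 2))) := by
  have : SecondCountableTopology X := UniformSpace.secondCountable_of_separable X
  have hD : 0 < D := hX.1
  have hfm : ∀ n, Measurable[ℱ n] (f n) := fun n ↦ (hf.stronglyMeasurable n).measurable
  have hS' : ∀ᵐ ω ∂μ, BanachMartingale.squareFunction f ω ≤ ENNReal.ofReal b := by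
    rw [eLpNorm_exponent_top] at hS
    filter_upwards [ae_le_eLpNormEssSup (f := BanachMartingale.squareFunction f) (μ := μ)]
      with ω hω
    exact hω.trans hS
  -- The minimizer of `l² D² b² / 2 - l r`.
  set l := r / (D ^ 2 * b ^ 2) with hl
  have hl0 : 0 ≤ l := by positivity
  -- The supremum may equal `r` without being attained, so the bound is proved for `s < r` and then
  -- `s` tends to `r`.
  have hbound : ∀ s < r,
      μ.real {ω | ENNReal.ofReal r ≤ BanachMartingale.maximalFunction f ω} ≤
        2 * Real.exp (l ^ 2 * D ^ 2 / 2 * b ^ 2 - l * s) := by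
    intro s hs
    refine le_trans (measureReal_mono ?_ (measure_ne_top _ _))
      (BanachMartingale.measureReal_iUnion_le hX hfm hf0 hb.le hS' hsymm hl0 s)
    intro ω hω
    simp only [Set.mem_iUnion, Set.mem_ofPred_eq]
    by_contra! hlt
    have hs0 : 0 < s := (norm_nonneg _).trans_lt (hlt 0)
    have hle : BanachMartingale.maximalFunction f ω ≤ ENNReal.ofReal s := iSup_le fun n ↦ by
      rw [← ofReal_norm]
      exact ENNReal.ofReal_le_ofReal (hlt n).le
    have := (ENNReal.ofReal_le_ofReal_iff hs0.le).1 (le_trans hω hle)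
    linarith
  have hlim : Filter.Tendsto (fun s ↦ 2 * Real.exp (l ^ 2 * D ^ 2 / 2 * b ^ 2 - l * s))
      (nhdsWithin r (Set.Iio r)) (nhds (2 * Real.exp (l ^ 2 * D ^ 2 / 2 * b ^ 2 - l * r))) :=
    (Continuous.tendsto (by fun_prop) r).mono_left nhdsWithin_le_nhds
  refine (ge_of_tendsto hlim (Filter.eventually_of_mem self_mem_nhdsWithin hbound)).trans_eq ?_
  congr 2
  rw [hl]
  field_simp
  ring
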